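/- For $n\in\mathbb N=\{1,2,\dots\}$ let $M_n$ be the algebra of complex $n\times n$ matrices with the operator norm coming from the Euclidean space $\mathbb C^n$, let $\mathrm{U}(n)\subseteq M_n$ be the set of unitary matrices, let $\operatorname{tr}_n(X)=\frac1n\operatorname{Tr}(X)$, and identify $M_d\otimes M_k$ with $M_{dk}$ by the Kronecker product. Let $\delta_d\colon M_d\to M_d$, $\delta_d(X)=\operatorname{tr}_d(X)I_d$, be the completely depolarising channel, and for $C\in M_k$ let $S_C\colon M_k\to M_k$, $S_C(X)=(c_{i,j}x_{i,j})$, be Schur multiplication by $C$. Let $\mathrm{MU}(n)$ be the set of mixed unitary maps on $M_n$, i.e. the convex hull of the maps $X\mapsto UXU^*$ with $U\in \mathrm{U}(n)$. For a linear map $\Phi\colon M_n\to M_n$ let $\|\Phi\|$ be its operator norm, let $\|\Phi\|_{cb}=\sup_{m\in\mathbb N}\|\mathrm{id}_{M_m}\otimes\Phi\|$ be its completely bounded norm, and put \[\operatorname{dist}(\Phi,\mathrm{MU}(n))=\inf_{\Psi\in \mathrm{MU}(n)}\|\Phi-\Psi\|,\qquad \operatorname{dist}_{cb}(\Phi,\mathrm{MU}(n))=\inf_{\Psi\in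 \mathrm{MU}(n)}\|\Phi-\Psi\|_{cb}.\] Let $\mathcal F_k(d)=\{(\operatorname{tr}_d(U_i^*U_j))_{i,j=1}^k : U_1,\dots,U_k\in \mathrm{U}(d)\}$ and $\mathcal F_k=\overline{\bigcup_{d\in\mathbb N}\mathcal F_k(d)}\subseteq M_k$. Theorem. Let $C\in M_k$ be a correlation matrix, i.e. a positive semidefinite matrix all of whose diagonal entries equal $1$. The following are equivalent: (1) $C\in\mathcal F_k$; (2) $\inf_{d\in\mathbb N}\operatorname{dist}_{cb}(\delta_d\otimes S_C,\mathrm{MU}(dk))=0$; (3) $\inf_{d\in\mathbb N}\operatorname{dist}(\delta_d\otimes S_C,\mathrm{MU}(dk))=0$. -/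

import Mathlib

open scoped ENNReal ComplexOrder

noncomputable section

namespace SchurMU

/-- The complex square matrices with rows and columns indexed by `n`; the algebra `M_d` is
`Mat (Fin d)`, and `M_d ⊗ M_k` is realised as `Mat (Fin d × Fin k)` (Kronecker product). -/
abbrev Mat (n : Type) : Type := Matrix n n ℂ

/-- The normalised trace `tr_n(X) = Tr(X) / n`. -/
def normTrace {n : Type} [Fintype n] (X : Mat n) : ℂ :=
  (Fintype.card n : ℂ)⁻¹ * X.trace

/-- A correlation matrix: positive semidefinite with all diagonal entries equal to `1`. -/
def IsCorrelationMatrix {k : ℕ} (C : Mat (Fin k)) : Prop :=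
  C.PosSemidef ∧ ∀ i, C i i = 1

/-- `F_k(d)`: the `k × k` matrices `(tr_d(U_i^* U_j))` with `U_1, …, U_k` unitaries in `M_d`. -/
def unitaryMoments (k d : ℕ) : Set (Mat (Fin k)) :=
  {C | ∃ U : Fin k → Matrix.unitaryGroup (Fin d) ℂ,
    C = Matrix.of fun i j => normTrace (star (U i : Mat (Fin d)) * (U j : Mat (Fin d)))}

/-- `F_k`: the closure of the union of the sets `F_k(d)`, `d ≥ 1`. -/
def unitaryMomentsClosure (k : ℕ) : Set (Mat (Fin k)) :=
  closure (⋃ d : ℕ+, unitaryMoments k d)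

/-- The completely depolarising channel `X ↦ tr_d(X) I_d`. -/
def depolarising (n : Type) [Fintype n] [DecidableEq n] : Mat n →ₗ[ℂ] Mat n where
  toFun X := normTrace X • (1 : Mat n)
  map_add' X Y := by simp [normTrace, mul_add, add_smul]
  map_smul' c X := by simp [normTrace, smul_smul, mul_left_comm]

/-- The Schur multiplier `S_C : X ↦ C ∘ X` (entrywise product). -/
def schurMult {k : ℕ} (C : Mat (Fin k)) : Mat (Fin k) →ₗ[ℂ] Mat (Fin k) where
  toFun X := Matrix.hadamard C X
  map_add' X Y := Matrix.hadamard_add C X Y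
  map_smul' c X := Matrix.hadamard_smul C X c

/-- The tensor product `Φ ⊗ Ψ` of linear maps on matrix algebras, as a map on the Kronecker
product: it sends `A ⊗ B` to `Φ A ⊗ Ψ B`. -/
def tensorMap {m n : Type} [Fintype m] [DecidableEq m] [Fintype n] [DecidableEq n]
    (Φ : Mat m →ₗ[ℂ] Mat m) (Ψ : Mat n →ₗ[ℂ] Mat n) :
    Mat (m × n) →ₗ[ℂ] Mat (m × n) :=
  (kroneckerLinearEquiv m m n n ℂ).conj (TensorProduct.map Φ Ψ)

/-- The map `X ↦ U X U^*`. -/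
def conjMap {n : Type} [Fintype n] (U : Mat n) : Mat n →ₗ[ℂ] Mat n where
  toFun X := U * X * star U
  map_add' X Y := by simp [mul_add, add_mul]
  map_smul' c X := by simp

/-- The mixed unitary maps: the convex hull of the maps `X ↦ U X U^*` with `U` unitary. -/
def mixedUnitary (n : Type) [Fintype n] [DecidableEq n] : Set (Mat n →ₗ[ℂ] Mat n) :=
  convexHull ℝ (Set.range fun U : Matrix.unitaryGroup n ℂ => conjMap (U : Mat n))

section Norms

open scoped Matrix.Norms.L2Operator

/-- The norm of a linear map on `M_n`, where `M_n` carries the operator norm that comes from the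
Euclidean space `ℂ^n`. -/
def mapNorm {n : Type} [Fintype n] [DecidableEq n] (Φ : Mat n →ₗ[ℂ] Mat n) : ℝ≥0∞ :=
  ‖LinearMap.toContinuousLinearMap Φ‖ₑ

end Norms

/-- The completely bounded norm `sup_m ‖id_{M_m} ⊗ Φ‖`. -/
def cbNorm {n : Type} [Fintype n] [DecidableEq n] (Φ : Mat n →ₗ[ℂ] Mat n) : ℝ≥0∞ :=
  ⨆ m : ℕ, mapNorm (tensorMap (LinearMap.id : Mat (Fin m) →ₗ[ℂ] Mat (Fin m)) Φ)

/-- The distance to the mixed unitary maps in the norm of linear maps. -/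
def distMU {n : Type} [Fintype n] [DecidableEq n] (Φ : Mat n →ₗ[ℂ] Mat n) : ℝ≥0∞ :=
  ⨅ Ψ ∈ mixedUnitary n, mapNorm (Φ - Ψ)

/-- The distance to the mixed unitary maps in the completely bounded norm. -/
def distCbMU {n : Type} [Fintype n] [DecidableEq n] (Φ : Mat n →ₗ[ℂ] Mat n) : ℝ≥0∞ :=
  ⨅ Ψ ∈ mixedUnitary n, cbNorm (Φ - Ψ)

end SchurMU

end

/-
Let `W` be the block-diagonal unitary with blocks `U_i^*`. Conjugation by `W` maps `1 ⊗ E_{ij}` to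
`U_i^* U_j ⊗ E_{ij}`, so depolarising, conjugating by `W` and depolarising again is a mixed unitary
map, and it equals `δ_d ⊗ S_C` for `C = (tr_d(U_i^* U_j))`. A general `C ∈ F_k` is reached by
approximation, since `‖δ_d ⊗ S_B‖_cb ≤ ∑ |b_{ij}|` with no dependence on `d`.

Conversely, `C` is recovered from `δ_d ⊗ S_C` by a linear functional of the map, its Schur symbol,
whose entries are bounded by the norm of the map uniformly in `d`. So it suffices that the symbols
of mixed unitary maps lie in `F_k`. The symbol of conjugation by a unitary is the Gram matrix of its
diagonal blocks, which are contractions, with ones on the diagonal. Such a matrix is affine in each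
contraction separately, hence lies in `F_k` because `F_k` is closed and convex and contractions are
limits of convex combinations of unitaries.
-/

noncomputable section

namespace SchurMU

open scoped Kronecker Matrix
open Matrix (unitaryGroup)

section RussoDye

variable {A : Type*} [CStarAlgebra A]

lemma exists_unitary_mul_abs [PartialOrder A] [StarOrderedRing A] {a : A} (ha : IsUnit a) :
    ∃ u ∈ unitary A, u * CFC.abs a = a := by
  have hsq : CFC.abs a * CFC.abs a = star a * a := CFC.abs_mul_abs a
  obtain ⟨b, hb⟩ : IsUnit (CFC.abs a) :=
    ((Commute.refl _).isUnit_mul_iff.1 (hsq ▸ ha.star.mul ha)).1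
  have hb_star : star b = b :=
    Units.ext (by rw [Units.coe_star, hb, (CFC.abs_nonneg a).isSelfAdjoint.star_eq])
  rw [← hb] at hsq ⊢
  refine ⟨a * ↑b⁻¹, (ha.mul b⁻¹.isUnit).mem_unitary_of_star_mul_self ?_, by simp [mul_assoc]⟩
  calc star (a * (↑b⁻¹ : A)) * (a * ↑b⁻¹) = ↑b⁻¹ * (star a * a) * ↑b⁻¹ := by
        rw [star_mul, ← Units.coe_star_inv, hb_star]
        simp only [mul_assoc]
    _ = 1 := by simp [← hsq]

lemma exists_unitary_add_unitary_eq_two_smul {a : A} (ha : IsUnit a) (hle : ‖a‖ ≤ 1) :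
    ∃ v ∈ unitary A, ∃ w ∈ unitary A, v + w = (2 : ℝ) • a := by
  let _ := CStarAlgebra.spectralOrder A
  let _ := CStarAlgebra.spectralOrderedRing A
  obtain ⟨u, hu, hua⟩ := exists_unitary_mul_abs ha
  let h : selfAdjoint A := ⟨CFC.abs a, (CFC.abs_nonneg a).isSelfAdjoint⟩
  have hh : ‖h‖ ≤ 1 := CFC.norm_abs.trans_le hle
  let p : unitary A := selfAdjoint.unitarySelfAddISMul h hh
  have hp : (p : A) + star (p : A) = (2 : ℝ) • CFC.abs a := by
    rw [selfAdjoint.star_coe_unitarySelfAddISMul, selfAdjoint.unitarySelfAddISMul_coe,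
      add_add_sub_cancel, two_smul]
  refine ⟨_, mul_mem hu p.2, _, mul_mem hu (Unitary.star_mem p.2), ?_⟩
  rw [← mul_add, hp, mul_smul_comm, hua]

lemma exists_unitary_add_unitary_eq_add {a u : A} (ha : ‖a‖ < 1) (hu : u ∈ unitary A) :
    ∃ v ∈ unitary A, ∃ w ∈ unitary A, v + w = a + u := by
  obtain _ | _ := subsingleton_or_nontrivial A
  · exact ⟨u, hu, u, hu, Subsingleton.elim _ _⟩
  have hunit : IsUnit (a + u) := by
    have hlt : ‖-(star u * a)‖ < 1 := by
      rwa [norm_neg, CStarRing.norm_mem_unitary_mul _ (Unitary.star_mem hu)]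
    convert (Unitary.isUnit_coe (U := ⟨u, hu⟩)).mul (isUnit_one_sub_of_norm_lt_one hlt) using 1
    rw [sub_neg_eq_add, mul_add, ← mul_assoc, Unitary.mul_star_self_of_mem hu]
    simp [add_comm]
  have hnorm : ‖(2⁻¹ : ℝ) • (a + u)‖ ≤ 1 := by
    rw [norm_smul, Real.norm_of_nonneg (by norm_num)]
    linarith [norm_add_le a u, CStarRing.norm_of_mem_unitary hu]
  simpa using exists_unitary_add_unitary_eq_two_smul
    (hunit.smul (Units.mk0 (2⁻¹ : ℝ) (by simp))) hnorm

/-- The **Russo–Dye theorem**. -/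
theorem closedBall_subset_closure_convexHull_unitary :
    Metric.closedBall (0 : A) 1 ⊆ closure (convexHull ℝ (unitary A : Set A)) := by
  rw [← closure_ball (0 : A) one_ne_zero]
  refine closure_minimal (fun a ha => ?_) isClosed_closure
  rw [mem_ball_zero_iff] at ha
  -- Gardner's argument: `a + v` is again a sum of two unitaries, which allows to iterate.
  have key (n : ℕ) : ∃ c ∈ convexHull ℝ (unitary A : Set A), ∃ v ∈ unitary A,
      (n + 1 : ℝ) • a + 1 = (n + 1 : ℝ) • c + v := by
    induction n with
    | zero =>
      obtain ⟨v, hv, w, hw, h⟩ := exists_unitary_add_unitary_eq_add ha (one_mem (unitary A))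
      exact ⟨v, subset_convexHull ℝ _ hv, w, hw, by simp [h]⟩
    | succ n ih =>
      obtain ⟨c, hc, u, hu, ih⟩ := ih
      obtain ⟨v, hv, w, hw, h⟩ := exists_unitary_add_unitary_eq_add ha hu
      have hn : (n + 1 + 1 : ℝ) ≠ 0 := by positivity
      refine ⟨((n + 1) / (n + 1 + 1) : ℝ) • c + (1 / (n + 1 + 1) : ℝ) • v,
        convex_convexHull ℝ _ hc (subset_convexHull ℝ _ hv) (by positivity) (by positivity)
          (by field_simp), w, hw, ?_⟩
      push_cast
      rw [smul_add, smul_smul, smul_smul, mul_div_cancel₀ _ hn, mul_one_div_cancel hn, one_smul,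
        add_assoc (_ • c), h, add_left_comm, ← ih, add_smul (n + 1 : ℝ), one_smul]
      abel
  choose c hc v hv hcv using key
  refine mem_closure_of_tendsto (f := c) (b := Filter.atTop) ?_ (.of_forall hc)
  have hca (n : ℕ) : c n = a - (1 / (n + 1 : ℝ)) • (v n - 1) := by
    have hn : (n + 1 : ℝ) ≠ 0 := by positivity
    rw [← sub_eq_sub_iff_add_eq_add.2 ((hcv n).trans (add_comm _ _)), ← smul_sub, smul_smul,
      one_div_mul_cancel hn, one_smul, sub_sub_cancel]
  have hv_bdd (n : ℕ) : ‖v n - 1‖ ≤ ‖(1 : A)‖ + ‖(1 : A)‖ := by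
    refine (norm_sub_le _ _).trans (add_le_add_left ?_ _)
    simpa using (CStarRing.norm_mul_mem_unitary 1 (hv n)).le
  rw [funext hca]
  simpa using tendsto_const_nhds.sub
    ((tendsto_one_div_add_atTop_nhds_zero_nat (𝕜 := ℝ)).zero_smul_isBoundedUnder_le
      (Filter.isBoundedUnder_of ⟨_, hv_bdd⟩))

end RussoDye

section Convexity

lemma pi_closure_convexHull_subset {ι : Type*} [Finite ι] [DecidableEq ι] {E : ι → Type*}
    [∀ i, AddCommGroup (E i)] [∀ i, Module ℝ (E i)] [∀ i, TopologicalSpace (E i)]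
    {t : ∀ i, Set (E i)} {T : Set (∀ i, E i)} (hT : IsClosed T)
    (hconv : ∀ x i, Convex ℝ (Function.update x i ⁻¹' T)) (ht : Set.univ.pi t ⊆ T) :
    Set.univ.pi (fun i => closure (convexHull ℝ (t i))) ⊆ T := by
  obtain ⟨_⟩ := nonempty_fintype ι
  have key (s : Finset ι) :
      Set.univ.pi (fun i => if i ∈ s then convexHull ℝ (t i) else t i) ⊆ T := by
    induction s using Finset.induction_on with
    | empty => simpa using ht
    | insert a s ha ih =>
      intro x hx
      have hxa : x a ∈ convexHull ℝ (t a) := by simpa using hx a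
      have hsub : t a ⊆ Function.update x a ⁻¹' T := fun y hy => ih fun i _ => by
        obtain rfl | hi := eq_or_ne i a
        · simpa [ha] using hy
        · simpa [hi] using hx i
      simpa using convexHull_min hsub (hconv x a) hxa
  rw [← closure_pi_set]
  exact closure_minimal (by simpa using key Finset.univ) hT

lemma convex_of_isClosed_of_midpoint_mem {E : Type*} [AddCommGroup E] [Module ℝ E]
    [TopologicalSpace E] [ContinuousAdd E] [ContinuousSMul ℝ E] {S : Set E} (hS : IsClosed S)
    (hmid : ∀ x ∈ S, ∀ y ∈ S, midpoint ℝ x y ∈ S) : Convex ℝ S := by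
  refine convex_iff_segment_subset.2 fun x hx y hy => ?_
  rw [segment_eq_image_lineMap]
  let T : Set ℝ := AffineMap.lineMap x y ⁻¹' S
  have hcont : Continuous fun r : ℝ => AffineMap.lineMap x y r := by
    simp only [AffineMap.lineMap_apply_module]
    fun_prop
  have hT : IsClosed T := hS.preimage hcont
  have hT_mid {t u : ℝ} (ht : t ∈ T) (hu : u ∈ T) : midpoint ℝ t u ∈ T := by
    simpa only [T, Set.mem_preimage, AffineMap.map_midpoint] using hmid _ ht _ hu
  -- Halving the interval `[t, 1]` repeatedly produces points of `T` just above `t`.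
  have hT_seq {t : ℝ} (ht : t ∈ T) (n : ℕ) : t + (1 - t) * (1 / 2) ^ n ∈ T := by
    induction n with
    | zero => simpa [T] using hy
    | succ n ih =>
      convert hT_mid ht ih using 1
      rw [midpoint_eq_smul_add, invOf_eq_inv, smul_eq_mul]
      ring
  refine Set.image_subset_iff.2 ((hT.inter isClosed_Icc).Icc_subset_of_forall_exists_gt
    (by simpa [T] using hx) ?_)
  rintro t ⟨ht, ht0, ht1⟩ u (hu : t < u)
  obtain ⟨n, hn⟩ := exists_pow_lt_of_lt_one (sub_pos.2 hu) (one_half_lt_one (α := ℝ))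
  have hpos : (0 : ℝ) < (1 / 2) ^ n := by positivity
  exact ⟨_, hT_seq ht n, by nlinarith, by nlinarith⟩

lemma forall₂_mem_convexHull {E F G : Type*} [AddCommGroup E] [Module ℝ E] [AddCommGroup F]
    [Module ℝ F] [AddCommGroup G] [Module ℝ G] (f : E →ₗ[ℝ] F →ₗ[ℝ] G) {s : Set E} {t : Set F}
    {u : Set G} (hu : Convex ℝ u) (h : ∀ x ∈ s, ∀ y ∈ t, f x y ∈ u) :
    ∀ x ∈ convexHull ℝ s, ∀ y ∈ convexHull ℝ t, f x y ∈ u := by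
  have key (x) (hx : x ∈ s) : convexHull ℝ t ⊆ f x ⁻¹' u :=
    convexHull_min (h x hx) (hu.linear_preimage (f x))
  exact fun x hx y hy =>
    convexHull_min (fun x hx => key x hx hy) (hu.linear_preimage (f.flip y)) hx

end Convexity

section Moments

variable {n : Type} [Fintype n] [DecidableEq n] {k : ℕ}

lemma normTrace_one [Nonempty n] : normTrace (1 : Mat n) = 1 := by
  simp [normTrace]

lemma gram_mem_iUnion_unitaryMoments [Nonempty n] (U : Fin k → unitaryGroup n ℂ) :
    (Matrix.of fun i j => normTrace (star (U i : Mat n) * (U j : Mat n))) ∈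
      ⋃ d : ℕ+, unitaryMoments k d := by
  obtain ⟨d, hd⟩ : ∃ d : ℕ+, Fintype.card n = d := ⟨⟨_, Fintype.card_pos⟩, rfl⟩
  let e : n ≃ Fin d := Fintype.equivFinOfCardEq hd
  let φ : Mat n ≃ₐ[ℂ] Mat (Fin d) := Matrix.reindexAlgEquiv ℂ ℂ e
  have hφ_star (X : Mat n) : star (φ X) = φ (star X) := Matrix.conjTranspose_submatrix _ _ _
  have hφ_normTrace (X : Mat n) : normTrace (φ X) = normTrace X := by
    rw [normTrace, normTrace, Fintype.card_fin, hd]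
    exact congrArg _ (Equiv.sum_comp e.symm X.diag)
  refine Set.mem_iUnion.2 ⟨d, fun i => ⟨φ (U i), ?_⟩, ?_⟩
  · rw [Matrix.mem_unitaryGroup_iff, hφ_star, ← map_mul,
      Unitary.mul_star_self_of_mem (U i).2, map_one]
  · ext i j
    simp only [Matrix.of_apply, hφ_star, ← map_mul, hφ_normTrace]

lemma normTrace_fromBlocks_kronecker_one {m : Type} [Fintype m] [DecidableEq m] [Nonempty m]
    [Nonempty n] (A : Mat m) (B : Mat n) :
    normTrace (Matrix.fromBlocks (A ⊗ₖ (1 : Mat n)) 0 0 ((1 : Mat m) ⊗ₖ B)) =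
      midpoint ℝ (normTrace A) (normTrace B) := by
  have htrace (X Y : Mat (m × n)) : (Matrix.fromBlocks X 0 0 Y).trace = X.trace + Y.trace := by
    simp [Matrix.trace, Fintype.sum_sum_type]
  have hm : (Fintype.card m : ℂ) ≠ 0 := by simp
  have hn : (Fintype.card n : ℂ) ≠ 0 := by simp
  simp only [normTrace, htrace, Matrix.trace_kronecker, Matrix.trace_one,
    Fintype.card_sum, Fintype.card_prod, midpoint_eq_smul_add, invOf_eq_inv, Complex.real_smul]
  push_cast
  field_simp
  ring

lemma midpoint_mem_iUnion_unitaryMoments {C D : Mat (Fin k)}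
    (hC : C ∈ ⋃ d : ℕ+, unitaryMoments k d) (hD : D ∈ ⋃ d : ℕ+, unitaryMoments k d) :
    midpoint ℝ C D ∈ ⋃ d : ℕ+, unitaryMoments k d := by
  obtain ⟨d, U, rfl⟩ := Set.mem_iUnion.1 hC
  obtain ⟨e, V, rfl⟩ := Set.mem_iUnion.1 hD
  let W (i : Fin k) : Mat ((Fin d × Fin e) ⊕ (Fin d × Fin e)) :=
    Matrix.fromBlocks ((U i : Mat (Fin d)) ⊗ₖ (1 : Mat (Fin e))) 0 0
      ((1 : Mat (Fin d)) ⊗ₖ (V i : Mat (Fin e)))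
  have hWW (i j) : star (W i) * W j =
      Matrix.fromBlocks ((star (U i : Mat (Fin d)) * (U j : Mat (Fin d))) ⊗ₖ (1 : Mat (Fin e))) 0 0
        ((1 : Mat (Fin d)) ⊗ₖ (star (V i : Mat (Fin e)) * (V j : Mat (Fin e)))) := by
    simp [W, Matrix.star_eq_conjTranspose, Matrix.fromBlocks_conjTranspose,
      Matrix.fromBlocks_multiply, Matrix.conjTranspose_kronecker, ← Matrix.mul_kronecker_mul]
  have hW (i) : W i ∈ unitaryGroup _ ℂ := by
    rw [Matrix.mem_unitaryGroup_iff', hWW, Unitary.coe_star_mul_self, Unitary.coe_star_mul_self,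
      Matrix.one_kronecker_one, Matrix.fromBlocks_one]
  convert gram_mem_iUnion_unitaryMoments fun i => (⟨W i, hW i⟩ : unitaryGroup _ ℂ) using 1
  ext i j
  simp only [Matrix.of_apply, hWW, normTrace_fromBlocks_kronecker_one]
  simp [midpoint_eq_smul_add]

theorem convex_unitaryMomentsClosure (k : ℕ) : Convex ℝ (unitaryMomentsClosure k) := by
  have hcont : Continuous fun p : Mat (Fin k) × Mat (Fin k) => midpoint ℝ p.1 p.2 := by
    simp only [midpoint_eq_smul_add]
    fun_prop
  exact convex_of_isClosed_of_midpoint_mem isClosed_closure fun _ hx _ hy =>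
    map_mem_closure₂ hcont hx hy fun _ hC _ hD => midpoint_mem_iUnion_unitaryMoments hC hD

end Moments

section Contractions

variable {n : Type} [Fintype n] {k : ℕ}

/-- The Gram matrix `(tr_n(A_i^* A_j))` of a family of matrices, with its diagonal replaced by
ones, so that each entry is real-affine in each `A_i` separately. -/
def unitGram (A : Fin k → Mat n) : Mat (Fin k) :=
  Matrix.of fun i j => if i = j then 1 else normTrace (star (A i) * A j)

lemma continuous_unitGram : Continuous (unitGram : (Fin k → Mat n) → Mat (Fin k)) := by
  refine continuous_matrix fun i j => ?_
  simp only [unitGram, normTrace, Matrix.of_apply]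
  split_ifs <;> fun_prop

lemma convex_preimage_unitGram_update (A : Fin k → Mat n) (i : Fin k) {S : Set (Mat (Fin k))}
    (hS : Convex ℝ S) : Convex ℝ (Function.update A i ⁻¹' (unitGram ⁻¹' S)) := by
  intro X hX Y hY a b ha hb hab
  have haff : unitGram (Function.update A i (a • X + b • Y)) =
      a • unitGram (Function.update A i X) + b • unitGram (Function.update A i Y) := by
    have hab' : (a : ℂ) + b = 1 := by exact_mod_cast hab
    ext p q
    by_cases hpq : p = q
    · simp [unitGram, hpq, hab']
    obtain rfl | hp := eq_or_ne p i
    · simp [unitGram, hpq, Ne.symm hpq, normTrace, add_mul, mul_add, mul_left_comm]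
    obtain rfl | hq := eq_or_ne q i
    · simp [unitGram, hpq, normTrace, mul_add, mul_left_comm]
    · simp [unitGram, hpq, hp, hq, ← add_mul, hab']
  simpa only [Set.mem_preimage, haff] using hS hX hY ha hb hab

variable [DecidableEq n] [Nonempty n]

lemma unitGram_coe_unitary (U : Fin k → unitaryGroup n ℂ) :
    unitGram (fun i => (U i : Mat n)) =
      Matrix.of fun i j => normTrace (star (U i : Mat n) * (U j : Mat n)) := by
  ext i j
  obtain rfl | h := eq_or_ne i j
  · simp [unitGram, normTrace_one]
  · simp [unitGram, h]

open scoped Matrix.Norms.L2Operator in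
theorem unitGram_mem_unitaryMomentsClosure {A : Fin k → Mat n}
    (hA : ∀ i, ‖A i‖ ≤ 1) : unitGram A ∈ unitaryMomentsClosure k := by
  have hunitary : Set.univ.pi (fun _ : Fin k => (unitary (Mat n) : Set (Mat n))) ⊆
      unitGram ⁻¹' unitaryMomentsClosure k := fun U hU => subset_closure <| by
    have := gram_mem_iUnion_unitaryMoments fun i => (⟨U i, hU i trivial⟩ : unitaryGroup n ℂ)
    rwa [← unitGram_coe_unitary] at this
  exact pi_closure_convexHull_subset (isClosed_closure.preimage continuous_unitGram)
    (fun A i => convex_preimage_unitGram_update A i (convex_unitaryMomentsClosure k)) hunitary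
    fun i _ => closedBall_subset_closure_convexHull_unitary (mem_closedBall_zero_iff.2 (hA i))

end Contractions

section TensorMap

variable {m n : Type}

lemma linearMap_ext_kronecker_single [Finite m] [Finite n] [DecidableEq n] {E : Type*}
    [AddCommMonoid E] [Module ℂ E] {Φ Ψ : Mat (m × n) →ₗ[ℂ] E}
    (h : ∀ (A : Mat m) (i j : n), Φ (A ⊗ₖ Matrix.single i j 1) = Ψ (A ⊗ₖ Matrix.single i j 1)) :
    Φ = Ψ := by
  classical
  refine Matrix.ext_linearMap ℂ fun ⟨a, i⟩ ⟨b, j⟩ => LinearMap.ext_ring ?_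
  simpa [Matrix.single_kronecker_single] using h (Matrix.single a b 1) i j

variable [Fintype m] [DecidableEq m] [Fintype n] [DecidableEq n]

@[simp]
lemma tensorMap_kronecker (Φ : Mat m →ₗ[ℂ] Mat m) (Ψ : Mat n →ₗ[ℂ] Mat n) (A : Mat m)
    (B : Mat n) : tensorMap Φ Ψ (A ⊗ₖ B) = Φ A ⊗ₖ Ψ B := by
  simp [tensorMap, LinearEquiv.conj_apply]

/-- The tensor product of linear maps on matrix algebras as a bilinear map. -/
def tensorMapₗ (m n : Type) [Fintype m] [DecidableEq m] [Fintype n] [DecidableEq n] :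
    (Mat m →ₗ[ℂ] Mat m) →ₗ[ℂ] (Mat n →ₗ[ℂ] Mat n) →ₗ[ℂ] (Mat (m × n) →ₗ[ℂ] Mat (m × n)) :=
  (TensorProduct.mapBilinear (.id ℂ) (Mat m) (Mat n) (Mat m) (Mat n)).compr₂
    (kroneckerLinearEquiv m m n n ℂ).conj.toLinearMap

lemma tensorMapₗ_apply (Φ : Mat m →ₗ[ℂ] Mat m) (Ψ : Mat n →ₗ[ℂ] Mat n) :
    tensorMapₗ m n Φ Ψ = tensorMap Φ Ψ := rfl

lemma tensorMap_comp (Φ Φ' : Mat m →ₗ[ℂ] Mat m) (Ψ Ψ' : Mat n →ₗ[ℂ] Mat n) :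
    tensorMap (Φ ∘ₗ Φ') (Ψ ∘ₗ Ψ') = tensorMap Φ Ψ ∘ₗ tensorMap Φ' Ψ' := by
  rw [tensorMap, TensorProduct.map_comp, LinearEquiv.conj_comp]
  rfl

lemma tensorMap_mulLeftRight (A B : Mat m) (A' B' : Mat n) :
    tensorMap (LinearMap.mulLeftRight ℂ (A, B)) (LinearMap.mulLeftRight ℂ (A', B')) =
      LinearMap.mulLeftRight ℂ (A ⊗ₖ A', B ⊗ₖ B') :=
  linearMap_ext_kronecker_single fun X i j => by
    simp [← Matrix.mul_kronecker_mul]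

lemma conjMap_comp_conjMap {n : Type} [Fintype n] (U V : Mat n) :
    conjMap U ∘ₗ conjMap V = conjMap (U * V) := by
  ext1 X
  simp [conjMap, mul_assoc]

lemma conjMap_eq_mulLeftRight {n : Type} [Fintype n] (U : Mat n) :
    conjMap U = LinearMap.mulLeftRight ℂ (U, star U) := by
  ext1 X
  simp [conjMap]

lemma tensorMap_conjMap (U : Mat m) (V : Mat n) :
    tensorMap (conjMap U) (conjMap V) = conjMap (U ⊗ₖ V) := by
  simp only [conjMap_eq_mulLeftRight, tensorMap_mulLeftRight, Matrix.star_eq_conjTranspose,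
    Matrix.conjTranspose_kronecker]

end TensorMap

section MixedUnitary

variable {m n : Type} [Fintype m] [DecidableEq m] [Fintype n] [DecidableEq n]

lemma conjMap_mem_mixedUnitary {U : Mat n} (hU : U ∈ unitaryGroup n ℂ) :
    conjMap U ∈ mixedUnitary n :=
  subset_convexHull ℝ _ ⟨⟨U, hU⟩, rfl⟩

lemma id_mem_mixedUnitary : LinearMap.id ∈ mixedUnitary n := by
  have h : conjMap (1 : Mat n) = LinearMap.id := by
    ext1 X
    simp [conjMap]
  exact h ▸ conjMap_mem_mixedUnitary (one_mem _)

lemma comp_mem_mixedUnitary {Φ Ψ : Mat n →ₗ[ℂ] Mat n} (hΦ : Φ ∈ mixedUnitary n)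
    (hΨ : Ψ ∈ mixedUnitary n) : Φ ∘ₗ Ψ ∈ mixedUnitary n := by
  refine forall₂_mem_convexHull
    ((LinearMap.llcomp ℂ (Mat n) (Mat n) (Mat n)).restrictScalars₁₂ ℝ ℝ)
    (convex_convexHull ℝ _) ?_ Φ hΦ Ψ hΨ
  rintro _ ⟨U, rfl⟩ _ ⟨V, rfl⟩
  change conjMap (U : Mat n) ∘ₗ conjMap (V : Mat n) ∈ mixedUnitary n
  rw [conjMap_comp_conjMap]
  exact conjMap_mem_mixedUnitary (mul_mem U.2 V.2)

lemma tensorMap_mem_mixedUnitary {Φ : Mat m →ₗ[ℂ] Mat m} {Ψ : Mat n →ₗ[ℂ] Mat n}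
    (hΦ : Φ ∈ mixedUnitary m) (hΨ : Ψ ∈ mixedUnitary n) :
    tensorMap Φ Ψ ∈ mixedUnitary (m × n) := by
  refine forall₂_mem_convexHull ((tensorMapₗ m n).restrictScalars₁₂ ℝ ℝ)
    (convex_convexHull ℝ _) ?_ Φ hΦ Ψ hΨ
  rintro _ ⟨U, rfl⟩ _ ⟨V, rfl⟩
  change tensorMap (conjMap (U : Mat m)) (conjMap (V : Mat n)) ∈ mixedUnitary (m × n)
  rw [tensorMap_conjMap]
  exact conjMap_mem_mixedUnitary (Matrix.kronecker_mem_unitary U.2 V.2)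

end MixedUnitary

section Depolarising

variable {G : Type} [AddCommGroup G] [Fintype G] [DecidableEq G]

/-- The Weyl–Heisenberg unitary of a finite abelian group `G` that composes the translation by `a`
with the multiplication by the character `χ`. -/
def weyl (a : G) (χ : AddChar G ℂ) : Mat G :=
  Matrix.of fun p q => if q = p + a then χ p else 0

lemma conjMap_weyl_apply (a : G) (χ : AddChar G ℂ) (X : Mat G) (p q : G) :
    conjMap (weyl a χ) X p q = χ (p - q) * X (p + a) (q + a) := by
  rw [sub_eq_add_neg, AddChar.map_add_eq_mul, AddChar.map_neg_eq_conj]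
  simp [conjMap, weyl, Matrix.mul_apply, mul_right_comm, apply_ite (starRingEnd ℂ)]

lemma weyl_mem_unitaryGroup (a : G) (χ : AddChar G ℂ) : weyl a χ ∈ unitaryGroup G ℂ := by
  rw [Matrix.mem_unitaryGroup_iff]
  ext p q
  have h := conjMap_weyl_apply a χ 1 p q
  simp only [conjMap, LinearMap.coe_mk, AddHom.coe_mk, mul_one] at h
  obtain rfl | hpq := eq_or_ne p q
  · simp [h]
  · simp [h, hpq]

lemma depolarising_apply {n : Type} [Fintype n] [DecidableEq n] (X : Mat n) :
    depolarising n X = normTrace X • (1 : Mat n) := rfl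

lemma depolarising_eq_sum_weyl :
    depolarising G =
      ∑ c : G × AddChar G ℂ, ((Fintype.card G : ℝ)⁻¹ ^ 2) • conjMap (weyl c.1 c.2) := by
  ext1 X
  ext p q
  have hG : (Fintype.card G : ℂ) ≠ 0 := by simp
  have htranslate : ∑ a, X (p + a) (p + a) = X.trace := Equiv.sum_comp (Equiv.addLeft p) X.diag
  simp only [← Finset.smul_sum, LinearMap.smul_apply, LinearMap.sum_apply, Matrix.smul_apply,
    Matrix.sum_apply, conjMap_weyl_apply, Fintype.sum_prod_type, ← Finset.sum_mul,
    AddChar.sum_apply_eq_ite, ← Finset.mul_sum, sub_eq_zero]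
  obtain rfl | hpq := eq_or_ne p q
  · simp only [depolarising_apply, normTrace, Matrix.smul_apply, Matrix.one_apply_eq, smul_eq_mul,
      mul_one, inv_pow, ↓reduceIte, htranslate, Complex.real_smul, Complex.ofReal_inv,
      Complex.ofReal_pow, Complex.ofReal_natCast]
    field_simp
  · simp [depolarising_apply, hpq]

lemma depolarising_mem_mixedUnitary : depolarising G ∈ mixedUnitary G := by
  rw [depolarising_eq_sum_weyl]
  refine (convex_convexHull ℝ _).sum_mem (fun _ _ => by positivity) ?_
    fun c _ => conjMap_mem_mixedUnitary (weyl_mem_unitaryGroup c.1 c.2)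
  have hG : (Fintype.card G : ℝ) ≠ 0 := by simp
  simp only [Finset.sum_const, Finset.card_univ, Fintype.card_prod, AddChar.card_eq, nsmul_eq_mul]
  push_cast
  field_simp

end Depolarising

section Norms

open scoped Matrix.Norms.L2Operator

section Matrix

variable {l m n o : Type*} [Fintype l] [Fintype m] [Fintype n] [Fintype o]

lemma norm_one_submatrix_le_one [DecidableEq m] {f : l → m} (hf : Function.Injective f) :
    ‖(1 : Matrix m m ℂ).submatrix f id‖ ≤ 1 := by
  classical
  have h := Matrix.l2_opNorm_conjTranspose_mul_self ((1 : Matrix m m ℂ).submatrix f id)ᴴ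
  rw [Matrix.conjTranspose_conjTranspose, Matrix.conjTranspose_submatrix,
    Matrix.conjTranspose_one, ← Matrix.submatrix_mul _ _ _ _ _ Function.bijective_id, one_mul,
    Matrix.submatrix_one f hf] at h
  rw [← Matrix.l2_opNorm_conjTranspose, Matrix.conjTranspose_submatrix, Matrix.conjTranspose_one]
  nlinarith [(IsStarProjection.one (R := Matrix l l ℂ)).norm_le]

lemma norm_submatrix_le [DecidableEq n] [DecidableEq o] (A : Matrix m n ℂ) {f : l → m} {g : o → n}
    (hf : Function.Injective f) (hg : Function.Injective g) : ‖A.submatrix f g‖ ≤ ‖A‖ := by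
  classical
  have h : A.submatrix f g =
      (1 : Matrix m m ℂ).submatrix f id * A * ((1 : Matrix n n ℂ).submatrix g id)ᴴ := by
    ext i j
    simp [Matrix.mul_apply, Matrix.one_apply]
  calc ‖A.submatrix f g‖ ≤ 1 * ‖A‖ * 1 := by
        rw [h]
        refine (Matrix.l2_opNorm_mul _ _).trans (mul_le_mul ((Matrix.l2_opNorm_mul _ _).trans ?_)
          ?_ (norm_nonneg _) (by positivity))
        · gcongr
          exact norm_one_submatrix_le_one hf
        · rw [Matrix.l2_opNorm_conjTranspose]
          exact norm_one_submatrix_le_one hg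
    _ = ‖A‖ := by ring

variable [DecidableEq n]

lemma norm_entry_le (A : Matrix m n ℂ) (i : m) (j : n) : ‖A i j‖ ≤ ‖A‖ := by
  calc ‖A i j‖ = ‖WithLp.toLp 2 (A *ᵥ Pi.single j 1) i‖ := by simp
    _ ≤ ‖WithLp.toLp 2 (A *ᵥ Pi.single j 1)‖ := PiLp.norm_apply_le _ i
    _ ≤ ‖A‖ := by simpa using Matrix.l2_opNorm_mulVec A (EuclideanSpace.single j (1 : ℂ))

lemma norm_normTrace_le {n : Type} [Fintype n] [DecidableEq n] (A : Mat n) :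
    ‖normTrace A‖ ≤ ‖A‖ := by
  have htrace : ‖A.trace‖ ≤ Fintype.card n * ‖A‖ := by
    simpa [Matrix.trace] using norm_sum_le_of_le Finset.univ fun i _ => norm_entry_le A i i
  rw [normTrace, norm_mul, norm_inv, Complex.norm_natCast]
  exact inv_mul_le_of_le_mul₀ (by positivity) (norm_nonneg _) htrace

lemma norm_single_one_le_one (i j : n) : ‖Matrix.single i j (1 : ℂ)‖ ≤ 1 := by
  have h := Matrix.l2_opNorm_conjTranspose_mul_self (Matrix.single i j (1 : ℂ))
  have hproj : IsStarProjection (Matrix.single j j (1 : ℂ)) :=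
    ⟨by simp [IsIdempotentElem], by simp [IsSelfAdjoint, Matrix.star_eq_conjTranspose]⟩
  rw [Matrix.conjTranspose_single, star_one, Matrix.single_mul_single_same, one_mul] at h
  nlinarith [hproj.norm_le, norm_nonneg (Matrix.single i j (1 : ℂ))]

variable [DecidableEq m]

lemma norm_one_kronecker_le (A : Matrix n n ℂ) : ‖(1 : Matrix m m ℂ) ⊗ₖ A‖ ≤ ‖A‖ := by
  let φ : Matrix n n ℂ →⋆ₙₐ[ℂ] Matrix (m × n) (m × n) ℂ :=
    { toFun X := 1 ⊗ₖ X
      map_smul' c X := Matrix.kronecker_smul c 1 X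
      map_zero' := Matrix.kronecker_zero 1
      map_add' := Matrix.kronecker_add 1
      map_mul' X Y := by rw [← Matrix.mul_kronecker_mul, one_mul]
      map_star' X := by
        simp only [Matrix.star_eq_conjTranspose, Matrix.conjTranspose_kronecker,
          Matrix.conjTranspose_one] }
  exact NonUnitalStarAlgHom.norm_apply_le φ A

lemma norm_one_kronecker [Nonempty m] (A : Matrix n n ℂ) : ‖(1 : Matrix m m ℂ) ⊗ₖ A‖ = ‖A‖ := by
  refine (norm_one_kronecker_le A).antisymm ?_
  obtain ⟨i⟩ := ‹Nonempty m›
  have h : ((1 : Matrix m m ℂ) ⊗ₖ A).submatrix (Prod.mk i) (Prod.mk i) = A := by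
    ext
    simp
  simpa only [h] using norm_submatrix_le ((1 : Matrix m m ℂ) ⊗ₖ A) (Prod.mk_right_injective i)
    (Prod.mk_right_injective i)

end Matrix

variable {n : Type} [Fintype n] [DecidableEq n]

lemma enorm_apply_le_mapNorm (Φ : Mat n →ₗ[ℂ] Mat n) (X : Mat n) :
    ‖Φ X‖ₑ ≤ mapNorm Φ * ‖X‖ₑ :=
  ContinuousLinearMap.le_opENorm (LinearMap.toContinuousLinearMap Φ) X

lemma mapNorm_le_of_bound {Φ : Mat n →ₗ[ℂ] Mat n} {M : ℝ≥0∞}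
    (h : ∀ X, ‖Φ X‖ₑ ≤ M * ‖X‖ₑ) : mapNorm Φ ≤ M :=
  ContinuousLinearMap.opENorm_le_bound (LinearMap.toContinuousLinearMap Φ) h

lemma mapNorm_zero : mapNorm (0 : Mat n →ₗ[ℂ] Mat n) = 0 := by
  refine le_antisymm (mapNorm_le_of_bound fun X => ?_) zero_le
  simp

lemma mapNorm_add_le (Φ Ψ : Mat n →ₗ[ℂ] Mat n) : mapNorm (Φ + Ψ) ≤ mapNorm Φ + mapNorm Ψ := by
  refine mapNorm_le_of_bound fun X => (enorm_add_le _ _).trans ?_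
  rw [add_mul]
  exact add_le_add (enorm_apply_le_mapNorm Φ X) (enorm_apply_le_mapNorm Ψ X)

lemma mapNorm_smul (c : ℂ) (Φ : Mat n →ₗ[ℂ] Mat n) : mapNorm (c • Φ) = ‖c‖ₑ * mapNorm Φ := by
  rw [mapNorm, mapNorm, map_smul, enorm_smul]

lemma mapNorm_comp_le (Φ Ψ : Mat n →ₗ[ℂ] Mat n) : mapNorm (Φ ∘ₗ Ψ) ≤ mapNorm Φ * mapNorm Ψ :=
  mapNorm_le_of_bound fun X => calc
    ‖Φ (Ψ X)‖ₑ ≤ mapNorm Φ * ‖Ψ X‖ₑ := enorm_apply_le_mapNorm Φ _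
    _ ≤ mapNorm Φ * (mapNorm Ψ * ‖X‖ₑ) := by gcongr; exact enorm_apply_le_mapNorm Ψ X
    _ = mapNorm Φ * mapNorm Ψ * ‖X‖ₑ := (mul_assoc _ _ _).symm

lemma mapNorm_mulLeftRight_le (A B : Mat n) :
    mapNorm (LinearMap.mulLeftRight ℂ (A, B)) ≤ ‖A‖ₑ * ‖B‖ₑ := by
  refine mapNorm_le_of_bound fun X => ?_
  have h : ‖A * X * B‖₊ ≤ ‖A‖₊ * ‖X‖₊ * ‖B‖₊ :=
    (nnnorm_mul_le _ _).trans (mul_le_mul_left (nnnorm_mul_le _ _) _)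
  rw [LinearMap.mulLeftRight_apply, mul_right_comm]
  simp only [enorm_eq_nnnorm]
  exact_mod_cast h

lemma mapNorm_le_one_of_mem_mixedUnitary {Φ : Mat n →ₗ[ℂ] Mat n} (hΦ : Φ ∈ mixedUnitary n) :
    mapNorm Φ ≤ 1 := by
  refine mapNorm_le_of_bound fun X => ?_
  rw [one_mul, enorm_le_iff_norm_le, ← mem_closedBall_zero_iff]
  refine convexHull_min ?_ ((convex_closedBall (0 : Mat n) ‖X‖).linear_preimage
    ((LinearMap.applyₗ X).restrictScalars ℝ)) hΦ
  rintro _ ⟨U, rfl⟩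
  have h : ‖(U : Mat n) * X * star (U : Mat n)‖ = ‖X‖ := by
    rw [CStarRing.norm_mul_mem_unitary _ (Unitary.star_mem U.2),
      CStarRing.norm_mem_unitary_mul _ U.2]
  exact mem_closedBall_zero_iff.2 h.le

lemma mapNorm_le_cbNorm (Φ : Mat n →ₗ[ℂ] Mat n) : mapNorm Φ ≤ cbNorm Φ := by
  refine le_iSup_of_le 1 (mapNorm_le_of_bound fun X => ?_)
  have h := enorm_apply_le_mapNorm
    (tensorMap (LinearMap.id : Mat (Fin 1) →ₗ[ℂ] Mat (Fin 1)) Φ) (1 ⊗ₖ X)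
  simpa only [tensorMap_kronecker, LinearMap.id_apply, enorm_eq_nnnorm, nnnorm,
    norm_one_kronecker] using h

lemma cbNorm_sum_le {ι : Type*} (s : Finset ι) (Φ : ι → Mat n →ₗ[ℂ] Mat n) :
    cbNorm (∑ i ∈ s, Φ i) ≤ ∑ i ∈ s, cbNorm (Φ i) := by
  refine iSup_le fun m => ?_
  rw [← tensorMapₗ_apply, map_sum]
  exact (Finset.le_sum_of_subadditive _ mapNorm_zero.le mapNorm_add_le s _).trans
    (Finset.sum_le_sum fun i _ => le_iSup_of_le m le_rfl)

lemma cbNorm_smul_le (c : ℂ) (Φ : Mat n →ₗ[ℂ] Mat n) : cbNorm (c • Φ) ≤ ‖c‖ₑ * cbNorm Φ := by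
  refine iSup_le fun m => ?_
  rw [← tensorMapₗ_apply, map_smul, mapNorm_smul, tensorMapₗ_apply]
  gcongr
  exact le_iSup_of_le m le_rfl

lemma cbNorm_comp_le (Φ Ψ : Mat n →ₗ[ℂ] Mat n) : cbNorm (Φ ∘ₗ Ψ) ≤ cbNorm Φ * cbNorm Ψ := by
  refine iSup_le fun m => ?_
  rw [← LinearMap.id_comp LinearMap.id, tensorMap_comp]
  refine (mapNorm_comp_le _ _).trans ?_
  gcongr <;> exact le_iSup_of_le m le_rfl

lemma cbNorm_mulLeftRight_le (A B : Mat n) :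
    cbNorm (LinearMap.mulLeftRight ℂ (A, B)) ≤ ‖A‖ₑ * ‖B‖ₑ := by
  refine iSup_le fun m => ?_
  have hid : (LinearMap.id : Mat (Fin m) →ₗ[ℂ] _) = LinearMap.mulLeftRight ℂ (1, 1) := by
    ext1 X
    simp
  rw [hid, tensorMap_mulLeftRight]
  refine (mapNorm_mulLeftRight_le _ _).trans ?_
  gcongr <;> exact enorm_le_iff_norm_le.2 (norm_one_kronecker_le _)

lemma cbNorm_le_one_of_mem_mixedUnitary {Φ : Mat n →ₗ[ℂ] Mat n} (hΦ : Φ ∈ mixedUnitary n) :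
    cbNorm Φ ≤ 1 :=
  iSup_le fun _ => mapNorm_le_one_of_mem_mixedUnitary
    (tensorMap_mem_mixedUnitary id_mem_mixedUnitary hΦ)

lemma cbNorm_tensorMap_mulLeftRight_le {m : Type} [Fintype m] [DecidableEq m]
    {Φ : Mat m →ₗ[ℂ] Mat m} (hΦ : Φ ∈ mixedUnitary m) (A B : Mat n) :
    cbNorm (tensorMap Φ (LinearMap.mulLeftRight ℂ (A, B))) ≤ ‖A‖ₑ * ‖B‖ₑ := by
  have hsplit : tensorMap Φ (LinearMap.mulLeftRight ℂ (A, B)) =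
      LinearMap.mulLeftRight ℂ (1 ⊗ₖ A, 1 ⊗ₖ B) ∘ₗ tensorMap Φ .id :=
    linearMap_ext_kronecker_single fun X i j => by
      simp [← Matrix.mul_kronecker_mul]
  have hΦ_id : cbNorm (tensorMap Φ (.id : Mat n →ₗ[ℂ] Mat n)) ≤ 1 :=
    cbNorm_le_one_of_mem_mixedUnitary (tensorMap_mem_mixedUnitary hΦ id_mem_mixedUnitary)
  calc cbNorm (tensorMap Φ (LinearMap.mulLeftRight ℂ (A, B)))
      ≤ cbNorm (LinearMap.mulLeftRight ℂ ((1 : Mat m) ⊗ₖ A, (1 : Mat m) ⊗ₖ B)) * 1 := by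
        rw [hsplit]
        exact (cbNorm_comp_le _ _).trans (by gcongr)
    _ ≤ ‖(1 : Mat m) ⊗ₖ A‖ₑ * ‖(1 : Mat m) ⊗ₖ B‖ₑ := by
        rw [mul_one]
        exact cbNorm_mulLeftRight_le _ _
    _ ≤ ‖A‖ₑ * ‖B‖ₑ := by
        gcongr <;> exact enorm_le_iff_norm_le.2 (norm_one_kronecker_le _)

end Norms

section Sufficiency

variable {n : Type} [Fintype n] [DecidableEq n] {k : ℕ}

lemma schurMult_single (C : Mat (Fin k)) (i j : Fin k) :
    schurMult C (Matrix.single i j 1) = C i j • Matrix.single i j 1 := by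
  ext p q
  by_cases h : i = p ∧ j = q
  · simp [schurMult, h]
  · simp [schurMult, h]

lemma schurMult_sub (B C : Mat (Fin k)) : schurMult (B - C) = schurMult B - schurMult C := by
  ext1 X
  ext i j
  exact sub_mul _ _ _

lemma schurMult_eq_sum_mulLeftRight (C : Mat (Fin k)) :
    schurMult C =
      ∑ i, ∑ j, C i j • LinearMap.mulLeftRight ℂ (Matrix.single i i 1, Matrix.single j j 1) := by
  ext1 X
  calc C.hadamard X = ∑ i, ∑ j, Matrix.single i j (C i j * X i j) :=
        Matrix.matrix_eq_sum_single _
    _ = _ := by simp [LinearMap.sum_apply, Matrix.single_mul_mul_single]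

open scoped Matrix.Norms.L2Operator in
lemma cbNorm_tensorMap_schurMult_le {Φ : Mat n →ₗ[ℂ] Mat n} (hΦ : Φ ∈ mixedUnitary n)
    (C : Mat (Fin k)) : cbNorm (tensorMap Φ (schurMult C)) ≤ ∑ i, ∑ j, ‖C i j‖ₑ := by
  have hsingle (i : Fin k) : ‖Matrix.single i i (1 : ℂ)‖ₑ ≤ 1 := by
    rw [← ofReal_norm, ENNReal.ofReal_le_one]
    exact norm_single_one_le_one i i
  have hterm (i j : Fin k) : cbNorm (tensorMap Φ
      (LinearMap.mulLeftRight ℂ (Matrix.single i i 1, Matrix.single j j 1))) ≤ 1 :=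
    (cbNorm_tensorMap_mulLeftRight_le hΦ _ _).trans (mul_le_one' (hsingle i) (hsingle j))
  simp only [schurMult_eq_sum_mulLeftRight, ← tensorMapₗ_apply, map_sum, map_smul]
  refine (cbNorm_sum_le _ _).trans (Finset.sum_le_sum fun i _ => (cbNorm_sum_le _ _).trans
    (Finset.sum_le_sum fun j _ => (cbNorm_smul_le _ _).trans ?_))
  exact mul_le_of_le_one_right' (hterm i j)

lemma conjMap_blockDiagonal_kronecker_single {n : Type} [Fintype n] (V : Fin k → Mat n)
    (A : Mat n) (i j : Fin k) :
    conjMap (Matrix.blockDiagonal V) (A ⊗ₖ Matrix.single i j 1) =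
      (V i * A * star (V j)) ⊗ₖ Matrix.single i j 1 := by
  ext ⟨a, p⟩ ⟨b, q⟩
  obtain rfl | hp := eq_or_ne i p <;> obtain rfl | hq := eq_or_ne j q <;>
    simp [conjMap, Matrix.mul_apply, Matrix.blockDiagonal_apply, Fintype.sum_prod_type,
      Matrix.single_apply, ite_and, Ne.symm, *]

lemma blockDiagonal_mem_unitaryGroup (V : Fin k → unitaryGroup n ℂ) :
    Matrix.blockDiagonal (fun i => (V i : Mat n)) ∈ unitaryGroup (n × Fin k) ℂ := by
  rw [Matrix.mem_unitaryGroup_iff, Matrix.star_eq_conjTranspose,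
    Matrix.blockDiagonal_conjTranspose, ← Matrix.blockDiagonal_mul, ← Matrix.blockDiagonal_one]
  exact congrArg _ (funext fun i => Unitary.mul_star_self_of_mem (V i).2)

theorem tensorMap_depolarising_schurMult_mem_mixedUnitary {d : ℕ} [NeZero d] {C : Mat (Fin k)}
    (hC : C ∈ unitaryMoments k d) :
    tensorMap (depolarising (Fin d)) (schurMult C) ∈ mixedUnitary (Fin d × Fin k) := by
  obtain ⟨U, rfl⟩ := hC
  let D : Mat (Fin d × Fin k) →ₗ[ℂ] Mat (Fin d × Fin k) := tensorMap (depolarising _) .id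
  have hD : D ∈ mixedUnitary _ :=
    tensorMap_mem_mixedUnitary depolarising_mem_mixedUnitary id_mem_mixedUnitary
  let W : Mat (Fin d × Fin k) := Matrix.blockDiagonal fun i => star (U i : Mat (Fin d))
  have hW : conjMap W ∈ mixedUnitary _ :=
    conjMap_mem_mixedUnitary (blockDiagonal_mem_unitaryGroup fun i => star (U i))
  convert comp_mem_mixedUnitary hD (comp_mem_mixedUnitary hW hD) using 1
  refine linearMap_ext_kronecker_single fun A i j => ?_
  simp [D, W, depolarising_apply, conjMap_blockDiagonal_kronecker_single, schurMult_single,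
    Matrix.smul_kronecker, Matrix.kronecker_smul, smul_smul, mul_comm, -Matrix.smul_single]

theorem sInf_range_distCbMU_eq_zero {C : Mat (Fin k)} (hC : C ∈ unitaryMomentsClosure k) :
    sInf (Set.range fun d : ℕ+ =>
      distCbMU (tensorMap (depolarising (Fin d)) (schurMult C))) = 0 := by
  have hcont : Continuous fun B : Mat (Fin k) => ∑ i, ∑ j, ‖(C - B) i j‖ₑ := by
    simp only [Matrix.sub_apply]
    fun_prop
  refine le_antisymm (le_of_forall_pos_le_add fun ε hε => ?_) zero_le
  obtain ⟨B, hBε, hB⟩ := mem_closure_iff.1 hC _ (hcont.isOpen_preimage _ (isOpen_Iio (a := ε)))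
    (by simpa using hε)
  obtain ⟨d, hBd⟩ := Set.mem_iUnion.1 hB
  have hsub : tensorMap (depolarising (Fin d)) (schurMult C) -
      tensorMap (depolarising (Fin d)) (schurMult B) =
        tensorMap (depolarising (Fin d)) (schurMult (C - B)) := by
    rw [schurMult_sub]
    exact (map_sub (tensorMapₗ (Fin d) (Fin k) (depolarising (Fin d))) _ _).symm
  refine (iInf_le_of_le d (iInf₂_le_of_le _
    (tensorMap_depolarising_schurMult_mem_mixedUnitary hBd) ?_)).trans_eq (zero_add ε).symm
  rw [hsub]
  exact (cbNorm_tensorMap_schurMult_le depolarising_mem_mixedUnitary _).trans hBε.le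

end Sufficiency

section Necessity

open scoped Matrix.Norms.L2Operator

variable {n : Type} [Fintype n] [DecidableEq n] {k : ℕ}

/-- The matrix unit `E_{ij}` for `i ≠ j`, and the identity on the diagonal, so that the symbol of
a unital map has ones on its diagonal. -/
def symbolInput (i j : Fin k) : Mat (Fin k) :=
  if i = j then 1 else Matrix.single i j 1

lemma symbolInput_apply (i j : Fin k) : symbolInput i j i j = 1 := by
  obtain rfl | h := eq_or_ne i j
  · simp [symbolInput]
  · simp [symbolInput, h]

lemma norm_symbolInput_le_one (i j : Fin k) : ‖symbolInput i j‖ ≤ 1 := by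
  unfold symbolInput
  split_ifs
  · exact (IsStarProjection.one (R := Mat (Fin k))).norm_le
  · exact norm_single_one_le_one i j

/-- The Schur symbol of a map `Φ` on `M_n ⊗ M_k`: the matrix of the normalised traces of the
`(i, j)` blocks of `Φ (1 ⊗ symbolInput i j)`. It recovers `C` from `δ_n ⊗ S_C`. -/
def schurSymbol (n : Type) [Fintype n] [DecidableEq n] (k : ℕ) :
    (Mat (n × Fin k) →ₗ[ℂ] Mat (n × Fin k)) →ₗ[ℂ] Mat (Fin k) where
  toFun Φ := Matrix.of fun i j =>
    normTrace ((Φ (1 ⊗ₖ symbolInput i j)).submatrix (·, i) (·, j))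
  map_add' Φ Ψ := by
    ext i j
    simp [normTrace, Matrix.trace, Finset.sum_add_distrib, mul_add]
  map_smul' c Φ := by
    ext i j
    simp [normTrace, Matrix.trace, ← Finset.mul_sum, mul_left_comm]

lemma schurSymbol_apply (Φ : Mat (n × Fin k) →ₗ[ℂ] Mat (n × Fin k)) (i j : Fin k) :
    schurSymbol n k Φ i j = normTrace ((Φ (1 ⊗ₖ symbolInput i j)).submatrix (·, i) (·, j)) := rfl

lemma enorm_schurSymbol_apply_le (Φ : Mat (n × Fin k) →ₗ[ℂ] Mat (n × Fin k)) (i j : Fin k) :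
    ‖schurSymbol n k Φ i j‖ₑ ≤ mapNorm Φ := calc
  ‖schurSymbol n k Φ i j‖ₑ ≤ ‖Φ (1 ⊗ₖ symbolInput i j)‖ₑ := by
    rw [schurSymbol_apply, enorm_le_iff_norm_le]
    exact (norm_normTrace_le _).trans
      (norm_submatrix_le _ (Prod.mk_left_injective i) (Prod.mk_left_injective j))
  _ ≤ mapNorm Φ * ‖(1 : Mat n) ⊗ₖ symbolInput i j‖ₑ := enorm_apply_le_mapNorm Φ _
  _ ≤ mapNorm Φ := mul_le_of_le_one_right' (by
    rw [← ofReal_norm, ENNReal.ofReal_le_one]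
    exact (norm_one_kronecker_le _).trans (norm_symbolInput_le_one i j))

lemma schurSymbol_tensorMap_depolarising_schurMult [Nonempty n] (C : Mat (Fin k)) :
    schurSymbol n k (tensorMap (depolarising n) (schurMult C)) = C := by
  ext i j
  rw [schurSymbol_apply, tensorMap_kronecker, depolarising_apply, normTrace_one, one_smul]
  have hblock : ((1 : Mat n) ⊗ₖ schurMult C (symbolInput i j)).submatrix (·, i) (·, j) =
      C i j • (1 : Mat n) := by
    ext a b
    simp [schurMult, symbolInput_apply, mul_comm]
  rw [hblock, normTrace, Matrix.trace_smul, smul_eq_mul, mul_left_comm, ← normTrace, normTrace_one,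
    mul_one]

lemma conjMap_one_kronecker_single_submatrix (U : Mat (n × Fin k)) (i j p q : Fin k) :
    (conjMap U (1 ⊗ₖ Matrix.single p q 1)).submatrix (·, i) (·, j) =
      U.submatrix (·, i) (·, p) * star (U.submatrix (·, j) (·, q)) := by
  ext a b
  simp [conjMap, Matrix.mul_apply, Fintype.sum_prod_type, Matrix.single_apply, Matrix.one_apply,
    ite_and]

lemma schurSymbol_conjMap [Nonempty n] {U : Mat (n × Fin k)} (hU : U ∈ unitaryGroup _ ℂ) :
    schurSymbol n k (conjMap U) = unitGram fun i => star (U.submatrix (·, i) (·, i)) := by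
  ext i j
  rw [schurSymbol_apply]
  obtain rfl | hij := eq_or_ne i j
  · have hone : conjMap U 1 = 1 := by
      simp [conjMap, Unitary.mul_star_self_of_mem hU]
    simp [symbolInput, unitGram, hone, normTrace_one,
      Matrix.submatrix_one _ (Prod.mk_left_injective i)]
  · simp [symbolInput, unitGram, hij, conjMap_one_kronecker_single_submatrix]

lemma schurSymbol_mem_unitaryMomentsClosure [Nonempty n]
    {Ψ : Mat (n × Fin k) →ₗ[ℂ] Mat (n × Fin k)} (hΨ : Ψ ∈ mixedUnitary (n × Fin k)) :
    schurSymbol n k Ψ ∈ unitaryMomentsClosure k := by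
  refine convexHull_min ?_ ((convex_unitaryMomentsClosure k).linear_preimage
    ((schurSymbol n k).restrictScalars ℝ)) hΨ
  rintro _ ⟨U, rfl⟩
  change schurSymbol n k (conjMap (U : Mat (n × Fin k))) ∈ unitaryMomentsClosure k
  rw [schurSymbol_conjMap U.2]
  refine unitGram_mem_unitaryMomentsClosure fun i => ?_
  rw [norm_star]
  have hU : ‖(U : Mat (n × Fin k))‖ ≤ 1 := by
    simpa using (CStarRing.norm_mul_mem_unitary (1 : Mat (n × Fin k)) U.2).trans_le
      (IsStarProjection.one (R := Mat (n × Fin k))).norm_le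
  exact (norm_submatrix_le _ (Prod.mk_left_injective i) (Prod.mk_left_injective i)).trans hU

theorem mem_unitaryMomentsClosure_of_sInf_range_distMU_eq_zero {C : Mat (Fin k)}
    (h : sInf (Set.range fun d : ℕ+ =>
      distMU (tensorMap (depolarising (Fin d)) (schurMult C))) = 0) :
    C ∈ unitaryMomentsClosure k := by
  refine isClosed_closure.closure_subset <|
    (EMetric.mem_closure_iff (α := Fin k → Fin k → ℂ)).2 fun ε hε => ?_
  obtain ⟨d, hd⟩ := iInf_lt_iff.1 (h.trans_lt hε)
  obtain ⟨Ψ, hΨ, hΨε⟩ := by simpa only [distMU, iInf_lt_iff, exists_prop] using hd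
  refine ⟨schurSymbol (Fin d) k Ψ, schurSymbol_mem_unitaryMomentsClosure hΨ,
    (edist_pi_le_iff.2 fun i => edist_pi_le_iff.2 fun j => ?_).trans_lt hΨε⟩
  calc edist (C i j) (schurSymbol (Fin d) k Ψ i j)
      = ‖schurSymbol (Fin d) k (tensorMap (depolarising (Fin d)) (schurMult C) - Ψ) i j‖ₑ := by
        rw [edist_eq_enorm_sub, map_sub, schurSymbol_tensorMap_depolarising_schurMult,
          Matrix.sub_apply]
    _ ≤ mapNorm (tensorMap (depolarising (Fin d)) (schurMult C) - Ψ) :=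
        enorm_schurSymbol_apply_le _ i j

end Necessity

end SchurMU

end

theorem theorem3p6_general (k : ℕ) (C : SchurMU.Mat (Fin k)) :
    List.TFAE
      [ C ∈ SchurMU.unitaryMomentsClosure k,
        sInf (Set.range fun d : ℕ+ => SchurMU.distCbMU
          (SchurMU.tensorMap (SchurMU.depolarising (Fin d)) (SchurMU.schurMult C))) = 0,
        sInf (Set.range fun d : ℕ+ => SchurMU.distMU
          (SchurMU.tensorMap (SchurMU.depolarising (Fin d)) (SchurMU.schurMult C))) = 0 ] := by
  tfae_have 1 → 2 := SchurMU.sInf_range_distCbMU_eq_zero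
  tfae_have 2 → 3 := fun h => by
    rw [← nonpos_iff_eq_zero, ← h]
    exact iInf_mono fun d => iInf₂_mono fun Ψ _ => SchurMU.mapNorm_le_cbNorm _
  tfae_have 3 → 1 := SchurMU.mem_unitaryMomentsClosure_of_sInf_range_distMU_eq_zero
  tfae_finish

theorem theorem3p6 (k : ℕ) (C : SchurMU.Mat (Fin k)) (hC : SchurMU.IsCorrelationMatrix C) :
    List.TFAE
      [ C ∈ SchurMU.unitaryMomentsClosure k,
        sInf (Set.range fun d : ℕ+ => SchurMU.distCbMU
          (SchurMU.tensorMap (SchurMU.depolarising (Fin d)) (SchurMU.schurMult C))) = 0,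
        sInf (Set.range fun d : ℕ+ => SchurMU.distMU
          (SchurMU.tensorMap (SchurMU.depolarising (Fin d)) (SchurMU.schurMult C))) = 0 ] :=
  theorem3p6_general k C
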